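/- Let $U\subset\mathbb{R}^n$ be a contractible open set, let $f$ be a vector field of class $C^\infty$ on $U$, and let $y:\mathbb{R}\to U$ be a periodic solution of the autonomous system $\dot y=f(y)$ whose orbit $\{y(t):t\in\mathbb{R}\}$ is an unknotted circle, i.e. some homeomorphism of $S^n=\mathbb{R}^n\cup\{\infty\}$ (identified by stereographic projection) maps the orbit onto the standard circle $\{(x_0,x_1,0,\dots,0)\}\cap S^n$. Then there exist a $C^\infty$ function $H:U\to\mathbb{R}$ and a $C^\infty$ matrix-valued function $B=(b_{ij}):U\to\mathbb{R}^{n\times n}$ such that * $b_{ij}=-b_{ji}$ on $U$ for all $i,j$; * $\displaystyle\sum_{l=1}^{n}\Big(\frac{\partial b_{ij}}{\partial y_l}b_{lk}+\frac{\partial b_{jk}}{\partial y_l}b_{li}+\frac{\partial b_{ki}}{\partial y_l}b_{lj}\Big)=0$ on $U$ for all $i,j,k$; * $B(x)$ has rank $2$ for every $x\in U$; and $y$ also satisfies the Poisson system: $\dot y(t)=B(y(t))\nabla H(y(t))$ for all $t\in\mathbb{R}$. -/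

import Mathlib

open scoped ContDiff

noncomputable section

/-- `y : ℝ → ℝⁿ` is a solution, defined for all times and staying in `U`, of the autonomous
system `ẏ = g(y)`, `y ∈ U`. -/
def IsSolutionIn {n : ℕ} (U : Set (EuclideanSpace ℝ (Fin n)))
    (g : EuclideanSpace ℝ (Fin n) → EuclideanSpace ℝ (Fin n))
    (y : ℝ → EuclideanSpace ℝ (Fin n)) : Prop :=
  ∀ t : ℝ, y t ∈ U ∧ HasDerivAt y (g (y t)) t

/-- The partial derivative `∂F/∂y_l` at `x`. -/
def partialDeriv {n : ℕ} (F : EuclideanSpace ℝ (Fin n) → ℝ) (l : Fin n)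
    (x : EuclideanSpace ℝ (Fin n)) : ℝ :=
  fderiv ℝ F x (EuclideanSpace.single l 1)

/-- `B` is a smooth matrix-valued function on `U` for which `{F, G} = ∇Fᵀ B ∇G` is a Poisson
bracket: it is skew-symmetric and satisfies the Jacobi identity in coordinates. -/
structure IsPoissonMatrixOn {n : ℕ} (U : Set (EuclideanSpace ℝ (Fin n)))
    (B : EuclideanSpace ℝ (Fin n) → Matrix (Fin n) (Fin n) ℝ) : Prop where
  smooth : ∀ i j : Fin n, ContDiffOn ℝ ∞ (fun x => B x i j) U
  skew : ∀ x ∈ U, ∀ i j : Fin n, B x i j = -B x j i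
  jacobi : ∀ x ∈ U, ∀ i j k : Fin n,
    ∑ l : Fin n,
      (partialDeriv (fun z => B z i j) l x * B x l k
        + partialDeriv (fun z => B z j k) l x * B x l i
        + partialDeriv (fun z => B z k i) l x * B x l j) = 0

/-- The vector field `x ↦ B(x) ∇H(x)`. -/
def poissonField {n : ℕ} (B : EuclideanSpace ℝ (Fin n) → Matrix (Fin n) (Fin n) ℝ)
    (H : EuclideanSpace ℝ (Fin n) → ℝ) (x : EuclideanSpace ℝ (Fin n)) :
    EuclideanSpace ℝ (Fin n) :=
  WithLp.toLp 2 ((B x).mulVec (WithLp.ofLp (gradient H x)))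

/-- The unit sphere `Sᵐ` in `ℝᵐ⁺¹`. -/
abbrev UnitSphere (m : ℕ) : Type :=
  Metric.sphere (0 : EuclideanSpace ℝ (Fin (m + 1))) 1

/-- The trivial knot in `Sᵐ`: the image of the standard embedding
`S¹ → Sᵐ, (x₀, x₁) ↦ (x₀, x₁, 0, …, 0)`. -/
def trivialKnot (m : ℕ) : Set (UnitSphere m) :=
  {x | ∀ i : Fin (m + 1), 2 ≤ (i : ℕ) → (x : EuclideanSpace ℝ (Fin (m + 1))) i = 0}

/-- A subset of `Sᵐ` is an unknotted circle if some homeomorphism of `Sᵐ` maps it onto the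
trivial knot. (Such a set is in particular an embedded circle when `1 ≤ m`.) -/
def IsUnknottedInSphere {m : ℕ} (K : Set (UnitSphere m)) : Prop :=
  ∃ h : UnitSphere m ≃ₜ UnitSphere m, h '' K = trivialKnot m

/-- The pole `(0, …, 0, 1)` of `Sⁿ`. -/
def northPole (n : ℕ) : UnitSphere n :=
  ⟨EuclideanSpace.single (Fin.last n) 1, by simp⟩

/-- The inclusion `ℝⁿ ⊂ ℝⁿ ∪ {∞} = Sⁿ`, i.e. inverse stereographic projection from the pole. -/
def toUnitSphere (n : ℕ) (x : EuclideanSpace ℝ (Fin n)) : UnitSphere n :=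
  haveI : Fact (Module.finrank ℝ (EuclideanSpace ℝ (Fin (n + 1))) = n + 1) :=
    ⟨finrank_euclideanSpace_fin⟩
  (stereographic' n (northPole n)).symm x

/-- A subset of `ℝⁿ` is an unknotted circle if it is one as a subset of `Sⁿ = ℝⁿ ∪ {∞}`. -/
def IsUnknotted {n : ℕ} (K : Set (EuclideanSpace ℝ (Fin n))) : Prop :=
  IsUnknottedInSphere (toUnitSphere n '' K)

end

open scoped ContDiff Topology RealInnerProductSpace Manifold Matrix

/-! It suffices to find a rank-two Poisson matrix `B` on all of ℝⁿ and a smooth `w(t)`, depending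
only on `y t`, with `B(y) w = ẏ`. Skewness makes `w` normal to the orbit, and a smooth normal field
along an embedded closed curve is the gradient of some function there (`exists_gradient_extension`);
that function is `H`. Unknottedness enters only through `2 ≤ n` and nonconstancy of `y`.

In the plane `B` is constant. For `n = 3`, `B` is the cross product with `∇G`, where `G` is a
submersion vanishing on the orbit (`exists_submersion`). To get `G`, start from a function regular
along the orbit and linear near infinity; a Sard perturbation leaves finitely many critical points,
and each is removed by composing with an injective immersion that fixes the orbit and omits the
point.

For `n ≥ 4`, project along a unit vector `v` so that the orbit stays embedded. The projected
velocity extends to a nowhere zero field `Y` normal to and invariant along `v`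
(`exists_transverse_field`), and `v ∧ Y` is Poisson since `v` and `Y` commute. -/

/-- A smooth periodic immersed curve which, like an orbit of an autonomous differential equation,
only meets itself by retracing itself. -/
structure IsPeriodicOrbit {E : Type*} [NormedAddCommGroup E] [NormedSpace ℝ E]
    (c : ℝ → E) (T : ℝ) : Prop where
  contDiff : ContDiff ℝ ∞ c
  pos : 0 < T
  periodic : Function.Periodic c T
  deriv_ne : ∀ t, deriv c t ≠ 0
  shift : ∀ t t' s, c t = c t' → c (t + s) = c (t' + s)

/-- The product of a smooth function with a function smooth on an open neighbourhood of its
support is smooth. -/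
theorem contDiff_smul_of_tsupport_subset {E F : Type*} [NormedAddCommGroup E] [NormedSpace ℝ E]
    [NormedAddCommGroup F] [NormedSpace ℝ F] {f : E → ℝ} {g : E → F} {N : Set E}
    (hN : IsOpen N) (hf : ContDiff ℝ ∞ f) (hfN : tsupport f ⊆ N) (hg : ContDiffOn ℝ ∞ g N) :
    ContDiff ℝ ∞ (fun x => f x • g x) := by
  rw [contDiff_iff_contDiffAt]
  intro x
  by_cases hx : x ∈ tsupport f
  · exact hf.contDiffAt.smul (hg.contDiffAt (hN.mem_nhds (hfN hx)))
  · have : (fun x => f x • g x) =ᶠ[𝓝 x] fun _ => 0 := by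
      filter_upwards [notMem_tsupport_iff_eventuallyEq.1 hx] with z hz
      simp [hz]
    exact contDiffAt_const.congr_of_eventuallyEq this

/-! ### Closed orbits: local parameters and extension off the curve -/

namespace IsPeriodicOrbit

section Normed
variable {E : Type*} [NormedAddCommGroup E] [NormedSpace ℝ E] {c : ℝ → E} {T : ℝ}

theorem hasDerivAt (hc : IsPeriodicOrbit c T) (t : ℝ) : HasDerivAt c (deriv c t) t :=
  (hc.contDiff.differentiable (by simp) t).hasDerivAt

theorem isCompact_range (hc : IsPeriodicOrbit c T) : IsCompact (Set.range c) := by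
  rw [← hc.periodic.image_Icc hc.pos 0]
  exact isCompact_Icc.image hc.contDiff.continuous

theorem contDiff_deriv (hc : IsPeriodicOrbit c T) : ContDiff ℝ ∞ (deriv c) := by
  have := hc.contDiff
  rw [contDiff_infty_iff_deriv] at this
  exact this.2

theorem deriv_eq (hc : IsPeriodicOrbit c T) {t t' : ℝ} (h : c t = c t') :
    deriv c t = deriv c t' := by
  have h1 : (fun s => c (t + s)) = fun s => c (t' + s) := funext fun s => hc.shift t t' s h
  have h2 := congrArg (fun g => deriv g 0) h1
  simpa [deriv_comp_const_add] using h2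

/-- Points of the curve close to `c t₀` have parameters close to `t₀`. -/
theorem exists_open_param_near (hc : IsPeriodicOrbit c T) (t₀ : ℝ) {V : Set ℝ} (hV : V ∈ 𝓝 t₀) :
    ∃ N : Set E, IsOpen N ∧ c t₀ ∈ N ∧ ∀ t, c t ∈ N → ∃ t' ∈ V, c t' = c t := by
  -- Parameters of all points that also have a parameter in the interior of `V`. By `shift` this set
  -- is open, so the rest of the curve is compact and can be removed.
  set W : Set ℝ := {t | ∃ t' ∈ interior V, c t' = c t}
  have hW : IsOpen W := by
    rw [isOpen_iff_mem_nhds]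
    rintro t ⟨t', ht', h⟩
    have h1 : Filter.Tendsto (fun s => t' + (s - t)) (𝓝 t) (𝓝 t') := by
      have : Continuous (fun s => t' + (s - t)) := by fun_prop
      simpa using this.tendsto t
    filter_upwards [h1 (isOpen_interior.mem_nhds ht')] with s hs
    refine ⟨_, hs, ?_⟩
    have := hc.shift t' t (s - t) h
    simpa using this
  have hK : IsCompact (c '' (Set.Icc 0 T \ W)) :=
    (isCompact_Icc.diff hW).image hc.contDiff.continuous
  refine ⟨(c '' (Set.Icc 0 T \ W))ᶜ, hK.isClosed.isOpen_compl, ?_, ?_⟩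
  · rintro ⟨s, hs, h⟩
    exact hs.2 ⟨t₀, mem_interior_iff_mem_nhds.2 hV, h.symm⟩
  · intro t ht
    obtain ⟨s, hs, hst⟩ : ∃ s ∈ Set.Icc 0 T, c s = c t := by
      have : c t ∈ c '' Set.Icc 0 (0 + T) := by
        rw [hc.periodic.image_Icc hc.pos 0]; exact ⟨t, rfl⟩
      simpa using this
    have : s ∈ W := by
      by_contra h
      exact ht ⟨s, ⟨hs, h⟩, hst⟩
    obtain ⟨t', h1, h2⟩ := this
    exact ⟨t', interior_subset h1, h2.trans hst⟩

end Normed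

variable {E : Type*} [NormedAddCommGroup E] [InnerProductSpace ℝ E] {c : ℝ → E} {T : ℝ}

/-- Near each of its points, the parameter of the curve extends to a smooth function. -/
theorem exists_local_param (hc : IsPeriodicOrbit c T) (t₀ : ℝ) :
    ∃ (N : Set E) (τ : E → ℝ), IsOpen N ∧ c t₀ ∈ N ∧ ContDiffOn ℝ ∞ τ N ∧
      ∀ t, c t ∈ N → c (τ (c t)) = c t := by
  -- The parameter is recovered from the coordinate along the tangent at `t₀`, by the inverse
  -- function theorem.
  set g : ℝ → ℝ := fun t => ⟪deriv c t₀, c t⟫ with hg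
  have hgs : ContDiff ℝ ∞ g := contDiff_const.inner ℝ hc.contDiff
  have hgd : ∀ t, HasDerivAt g ⟪deriv c t₀, deriv c t⟫ t := fun t => by
    simpa using (hasDerivAt_const t (deriv c t₀)).inner ℝ (hc.hasDerivAt t)
  have h0 : ⟪deriv c t₀, deriv c t₀⟫ ≠ 0 := by simpa using hc.deriv_ne t₀
  have hst : HasStrictFDerivAt g
      ((ContinuousLinearEquiv.unitsEquivAut ℝ (Units.mk0 _ h0) : ℝ ≃L[ℝ] ℝ) : ℝ →L[ℝ] ℝ) t₀ := by
    have h1 := hgs.contDiffAt.hasStrictDerivAt (x := t₀) (by simp)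
    rw [(hgd t₀).deriv] at h1
    refine h1.hasStrictFDerivAt.congr_fderiv ?_
    ext; simp
  set e := hst.toOpenPartialHomeomorph g with he
  have hecoe : ∀ t, e t = g t := fun t => rfl
  have hmem : t₀ ∈ e.source := hst.mem_toOpenPartialHomeomorph_source
  -- The second condition makes the local inverse smooth at every point used, not only at `g t₀`.
  set V : Set ℝ := e.source ∩ {t | ⟪deriv c t₀, deriv c t⟫ ≠ 0} with hVdef
  have hVo : IsOpen V := by
    refine e.open_source.inter (isOpen_ne_fun ?_ continuous_const)
    exact continuous_const.inner hc.contDiff_deriv.continuous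
  have hVt : V ∈ 𝓝 t₀ := hVo.mem_nhds ⟨hmem, h0⟩
  obtain ⟨N, hN, hN0, hNt⟩ := hc.exists_open_param_near t₀ hVt
  have hO : IsOpen (e.target ∩ e.symm ⁻¹' V) := e.symm.isOpen_inter_preimage hVo
  have hl : Continuous (fun x : E => ⟪deriv c t₀, x⟫) := by fun_prop
  refine ⟨N ∩ (fun x : E => ⟪deriv c t₀, x⟫) ⁻¹' (e.target ∩ e.symm ⁻¹' V),
    fun x => e.symm ⟪deriv c t₀, x⟫, hN.inter (hO.preimage hl), ⟨hN0, ?_⟩, ?_, ?_⟩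
  · show g t₀ ∈ e.target ∩ e.symm ⁻¹' V
    rw [← hecoe]
    refine ⟨e.map_source hmem, ?_⟩
    rw [Set.mem_preimage, e.left_inv hmem]
    exact ⟨hmem, h0⟩
  · intro x hx
    have h1 : ContDiffAt ℝ ∞ e.symm ⟪deriv c t₀, x⟫ := by
      refine e.contDiffAt_symm_deriv (f₀' := ⟪deriv c t₀, deriv c (e.symm ⟪deriv c t₀, x⟫)⟫)
        hx.2.2.2 hx.2.1 (hgd _) hgs.contDiffAt
    have h2 : ContDiffAt ℝ ∞ (fun x : E => ⟪deriv c t₀, x⟫) x :=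
      contDiffAt_const.inner ℝ contDiffAt_id
    exact (h1.comp x h2).contDiffWithinAt
  · rintro t ⟨ht, -⟩
    obtain ⟨t', ht', h⟩ := hNt t ht
    rw [← h]
    show c (e.symm (g t')) = c t'
    rw [← hecoe, e.left_inv ht'.1]

variable [FiniteDimensional ℝ E]

/-- A smooth function of the points of the curve extends to the whole space. -/
theorem exists_extension (hc : IsPeriodicOrbit c T) {F : Type*} [NormedAddCommGroup F]
    [NormedSpace ℝ F] {φ : ℝ → F} (hφ : ContDiff ℝ ∞ φ) (hφc : ∀ t t', c t = c t' → φ t = φ t') :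
    ∃ Φ : E → F, ContDiff ℝ ∞ Φ ∧ ∀ t, Φ (c t) = φ t := by
  -- The constraint is `{φ t}` on the curve and void off it, hence convex; a partition of unity
  -- glues the local extensions `φ ∘ τ`.
  have hconv : ∀ x : E, Convex ℝ {u : F | ∀ t, c t = x → u = φ t} := by
    intro x u hu v hv a b ha hb hab t ht
    rw [hu t ht, hv t ht, ← add_smul, hab, one_smul]
  obtain ⟨Φ, hΦ⟩ := exists_contMDiffMap_forall_mem_convex_of_local (n := ⊤) 𝓘(ℝ, E) hconv <| by
    intro x
    by_cases hx : x ∈ Set.range c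
    · obtain ⟨t₀, rfl⟩ := hx
      obtain ⟨N, τ, hN, h0, hτ, h⟩ := hc.exists_local_param t₀
      refine ⟨N, hN.mem_nhds h0, fun x => φ (τ x), ?_, ?_⟩
      · rw [contMDiffOn_iff_contDiffOn]
        exact hφ.comp_contDiffOn hτ
      · rintro z hz t rfl
        exact hφc _ _ (h t hz)
    · refine ⟨(Set.range c)ᶜ, hc.isCompact_range.isClosed.isOpen_compl.mem_nhds hx, fun _ => 0,
        contMDiffOn_const, ?_⟩
      rintro z hz t rfl
      exact absurd ⟨t, rfl⟩ hz
  exact ⟨Φ, Φ.contMDiff.contDiff, fun t => hΦ (c t) t rfl⟩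

/-- A smooth normal vector field along the curve is the gradient of a function vanishing on it. -/
theorem exists_gradient_extension (hc : IsPeriodicOrbit c T) {w : ℝ → E} (hw : ContDiff ℝ ∞ w)
    (hwc : ∀ t t', c t = c t' → w t = w t') (horth : ∀ t, ⟪w t, deriv c t⟫ = 0) :
    ∃ H : E → ℝ, ContDiff ℝ ∞ H ∧ ∀ t, H (c t) = 0 ∧ HasFDerivAt H (innerSL ℝ (w t)) (c t) := by
  -- Summing finitely many bumps times `⟪w (τ x), x - c (τ x)⟫` gives gradient `ρ w` with `ρ > 0` on
  -- the curve. Multiplying by an extension of `1/ρ` then corrects the factor, because `F` vanishes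
  -- there.
  obtain ⟨F, ρ, hF, hρ, hFρ, hρ0, hρ1⟩ : ∃ F ρ : E → ℝ, ContDiff ℝ ∞ F ∧ ContDiff ℝ ∞ ρ ∧
      (∀ t, F (c t) = 0 ∧ HasFDerivAt F (ρ (c t) • innerSL ℝ (w t)) (c t)) ∧
      (∀ x, 0 ≤ ρ x) ∧ ∀ x ∈ Set.range c, 0 < ρ x := by
    refine hc.isCompact_range.induction_on (p := fun S => ∃ F ρ : E → ℝ,
      ContDiff ℝ ∞ F ∧ ContDiff ℝ ∞ ρ ∧
      (∀ t, F (c t) = 0 ∧ HasFDerivAt F (ρ (c t) • innerSL ℝ (w t)) (c t)) ∧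
      (∀ x, 0 ≤ ρ x) ∧ ∀ x ∈ S, 0 < ρ x) ?_ ?_ ?_ ?_
    · refine ⟨fun _ => 0, fun _ => 0, contDiff_const, contDiff_const, fun t => ⟨rfl, ?_⟩, by simp,
        by simp⟩
      rw [zero_smul]
      exact hasFDerivAt_const _ _
    · rintro s t hst ⟨F, ρ, hF, hρ, h1, h2, h3⟩
      exact ⟨F, ρ, hF, hρ, h1, h2, fun x hx => h3 x (hst hx)⟩
    · rintro s t ⟨F, ρ, hF, hρ, h1, h2, h3⟩ ⟨F', ρ', hF', hρ', h1', h2', h3'⟩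
      refine ⟨fun x => F x + F' x, fun x => ρ x + ρ' x, hF.add hF', hρ.add hρ', fun t => ⟨?_, ?_⟩,
        fun x => add_nonneg (h2 x) (h2' x), ?_⟩
      · simp [(h1 t).1, (h1' t).1]
      · rw [add_smul]
        exact (h1 t).2.add (h1' t).2
      · rintro x (hx | hx)
        · exact add_pos_of_pos_of_nonneg (h3 x hx) (h2' x)
        · exact add_pos_of_nonneg_of_pos (h2 x) (h3' x hx)
    · rintro _ ⟨t₀, rfl⟩
      obtain ⟨N, τ, hN, h0, hτ, hτc⟩ := hc.exists_local_param t₀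
      obtain ⟨b, hbN, -, hb, hb01, hb1⟩ := exists_contDiff_tsupport_subset (n := ⊤) (hN.mem_nhds h0)
      have hb' : ContDiff ℝ ∞ b := hb
      have hg : ContDiffOn ℝ ∞ (fun x => ⟪w (τ x), x - c (τ x)⟫) N :=
        (hw.comp_contDiffOn hτ).inner ℝ (contDiffOn_id.sub (hc.contDiff.comp_contDiffOn hτ))
      have hS : {x | 0 < b x} ∈ 𝓝[Set.range c] (c t₀) := mem_nhdsWithin_of_mem_nhds <|
        (isOpen_lt continuous_const hb'.continuous).mem_nhds (by simp [hb1])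
      refine ⟨_, hS, fun x => b x • ⟪w (τ x), x - c (τ x)⟫, b,
        contDiff_smul_of_tsupport_subset hN hb' hbN hg, hb', fun t => ?_,
        fun x => (hb01 ⟨x, rfl⟩).1, fun x hx => hx⟩
      · by_cases ht : c t ∈ N
        · have e1 : c (τ (c t)) = c t := hτc t ht
          refine ⟨by simp [e1], ?_⟩
          have hτd : HasFDerivAt τ (fderiv ℝ τ (c t)) (c t) :=
            ((hτ.contDiffAt (hN.mem_nhds ht)).differentiableAt (by simp)).hasFDerivAt
          have hwd := ((hw.differentiable (by simp) (τ (c t))).hasFDerivAt).comp (c t) hτd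
          have hcd := (hc.hasDerivAt (τ (c t))).hasFDerivAt.comp (c t) hτd
          have h1 := hwd.inner ℝ ((hasFDerivAt_id (c t)).sub hcd)
          have h2 := ((hb'.differentiable (by simp) (c t)).hasFDerivAt).smul h1
          -- Differentiating `w ∘ τ` leaves the factor `x - c (τ x) = 0`; differentiating `c ∘ τ`
          -- gives a multiple of the velocity, orthogonal to `w`.
          refine h2.congr_fderiv ?_
          ext v
          have e2 : w (τ (c t)) = w t := hwc _ _ e1
          have e3 : deriv c (τ (c t)) = deriv c t := hc.deriv_eq e1
          simp [e1, e2, e3, inner_sub_right, inner_smul_right, horth]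
        · have hz : b =ᶠ[𝓝 (c t)] 0 := notMem_tsupport_iff_eventuallyEq.1 fun h => ht (hbN h)
          have hz0 : b (c t) = 0 := hz.self_of_nhds
          refine ⟨by simp [hz0], ?_⟩
          rw [hz0, zero_smul]
          refine (hasFDerivAt_const (0 : ℝ) (c t)).congr_of_eventuallyEq ?_
          filter_upwards [hz] with z hz
          simp [hz]
  obtain ⟨q, hq, hqc⟩ := hc.exists_extension (φ := fun t => (ρ (c t))⁻¹)
    ((hρ.comp hc.contDiff).inv fun t => (hρ1 _ ⟨t, rfl⟩).ne')
    (fun t t' h => by simp only [h])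
  refine ⟨fun x => q x * F x, hq.mul hF, fun t => ⟨by simp [(hFρ t).1], ?_⟩⟩
  have h1 := ((hq.differentiable (by simp) (c t)).hasFDerivAt).mul (hFρ t).2
  refine h1.congr_fderiv ?_
  rw [hqc, (hFρ t).1, zero_smul, add_zero, smul_smul, inv_mul_cancel₀ (hρ1 _ ⟨t, rfl⟩).ne',
    one_smul]

end IsPeriodicOrbit

/-! ### Removing critical points off the curve -/

/-- The derivative is `1 - b + b e⁻ˢ > 0`. The family joins the identity (`b = 0`) to `-e⁻ˢ` (`b =
1`), which omits `0`: this is the push along a line that will miss a point. -/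
theorem strictMono_sub_mul_add_exp_neg {b : ℝ} (h0 : 0 ≤ b) (h1 : b ≤ 1) :
    StrictMono fun s : ℝ => s - b * (s + Real.exp (-s)) := by
  intro s s' h
  have he : Real.exp (-s') < Real.exp (-s) := Real.exp_lt_exp.2 (neg_lt_neg h)
  show s - b * (s + Real.exp (-s)) < s' - b * (s' + Real.exp (-s'))
  rcases h0.eq_or_lt with rfl | hb
  · simpa using h
  · nlinarith [mul_pos hb (sub_pos.2 he), mul_nonneg (sub_nonneg.2 h1) (sub_pos.2 h).le]

namespace IsPeriodicOrbit

variable {E : Type*} [NormedAddCommGroup E] [InnerProductSpace ℝ E] [FiniteDimensional ℝ E]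
  {c : ℝ → E} {T : ℝ}

/-- In dimension at least three, a point off the curve lies on a line missing the curve. -/
theorem exists_line_disjoint (hc : IsPeriodicOrbit c T) (hE : 3 ≤ Module.finrank ℝ E) {p : E}
    (hp : p ∉ Set.range c) : ∃ v : E, v ≠ 0 ∧ ∀ t (s : ℝ), c t - p ≠ s • v := by
  -- The cone over the curve with vertex `p` has only two parameters; any `v` outside it works.
  have hd : Dense (Set.range fun q : ℝ × ℝ => q.2 • (c q.1 - p))ᶜ := by
    refine ContDiff.dense_compl_range_of_finrank_lt_finrank ?_ (by simp; omega)
    exact contDiff_snd.smul (((hc.contDiff.comp contDiff_fst).sub contDiff_const).of_le (by simp))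
  obtain ⟨v, hv⟩ := hd.nonempty
  refine ⟨v, ?_, ?_⟩
  · rintro rfl
    exact hv ⟨(0, 0), by simp⟩
  · intro t s h
    have hs : s ≠ 0 := by
      rintro rfl
      exact hp ⟨t, by simpa [sub_eq_zero] using h⟩
    exact hv ⟨(t, s⁻¹), by simp [h, smul_smul, inv_mul_cancel₀ hs]⟩

/-- In dimension at least three, the space can be immersed injectively in itself so as to fix the
curve and to miss a given point off the curve. -/
theorem exists_immersion_avoiding (hc : IsPeriodicOrbit c T) (hE : 3 ≤ Module.finrank ℝ E) {p : E}
    (hp : p ∉ Set.range c) :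
    ∃ ψ : E → E, ContDiff ℝ ∞ ψ ∧ Function.Injective ψ ∧ (∀ x h, fderiv ℝ ψ x h = 0 → h = 0) ∧
      (∀ t, ψ (c t) = c t) ∧ ∀ x, ψ x ≠ p := by
  obtain ⟨v, hv0, hv⟩ := hc.exists_line_disjoint hE hp
  set l : E →L[ℝ] ℝ := (‖v‖ ^ 2)⁻¹ • innerSL ℝ v with hl
  have hlv : l v = 1 := by
    simp only [hl, _root_.smul_apply, innerSL_apply_apply, smul_eq_mul,
      real_inner_self_eq_norm_sq]
    exact inv_mul_cancel₀ (by simpa using hv0)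
  set P : E →L[ℝ] E := ContinuousLinearMap.id ℝ E - l.smulRight v with hP
  have hPx : ∀ z, P z = z - l z • v := fun z => by simp [hP]
  have hPv : P v = 0 := by simp [hPx, hlv]
  -- Distance from the curve to the line `p + ℝv`; the bump below lives in the tube of this radius,
  -- so `ψ` fixes the curve.
  obtain ⟨ε, hε, hεc⟩ : ∃ ε > 0, ∀ t, ε ≤ ‖P (c t - p)‖ := by
    have hK : IsCompact ((fun x => P (x - p)) '' Set.range c) :=
      hc.isCompact_range.image (by fun_prop)
    have h0 : (0 : E) ∈ ((fun x => P (x - p)) '' Set.range c)ᶜ := by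
      rintro ⟨_, ⟨t, rfl⟩, h⟩
      simp only [hPx, sub_eq_zero] at h
      exact hv t _ h
    obtain ⟨ε, hε, h⟩ := Metric.isOpen_iff.1 hK.isClosed.isOpen_compl 0 h0
    refine ⟨ε, hε, fun t => ?_⟩
    by_contra hlt
    exact h (mem_ball_zero_iff.2 (not_le.1 hlt)) ⟨_, ⟨t, rfl⟩, rfl⟩
  let b : ContDiffBump (0 : E) := ⟨ε / 2, ε, by positivity, by linarith⟩
  have hb : ContDiff ℝ ∞ b := b.contDiff
  have hsm : ContDiff ℝ ∞ fun x : E => l (x - p) := l.contDiff.comp (contDiff_id.sub contDiff_const)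
  have hβ : ContDiff ℝ ∞ fun x : E => b (P (x - p)) :=
    hb.comp (P.contDiff.comp (contDiff_id.sub contDiff_const))
  -- Only the coordinate `s` along `v` changes, to `s - β(s + e⁻ˢ)`. On the line itself `β = 1`, and
  -- `-e⁻ˢ` never reaches the coordinate `0` of `p`.
  set ψ : E → E := fun x =>
    x - (b (P (x - p)) * (l (x - p) + Real.exp (-l (x - p)))) • v with hψ
  have hlψ : ∀ x, l (ψ x - p) =
      l (x - p) - b (P (x - p)) * (l (x - p) + Real.exp (-l (x - p))) := fun x => by
    simp only [hψ, map_sub, map_smul, hlv, smul_eq_mul]; ring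
  have hPψ : ∀ x, P (ψ x - p) = P (x - p) := fun x => by
    simp only [hψ, map_sub, map_smul, hPv, smul_zero, sub_zero]
  refine ⟨ψ, ?_, ?_, ?_, ?_, ?_⟩
  · exact contDiff_id.sub ((hβ.mul (hsm.add (Real.contDiff_exp.comp hsm.neg))).smul contDiff_const)
  · intro x x' h
    have h1 : P (x - p) = P (x' - p) := by rw [← hPψ x, ← hPψ x', h]
    have h2 : l (x - p) = l (x' - p) := by
      have := (hlψ x).symm.trans ((congrArg (fun z => l (z - p)) h).trans (hlψ x'))
      rw [← h1] at this
      exact (strictMono_sub_mul_add_exp_neg b.nonneg b.le_one).injective this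
    have h3 := h1
    rw [hPx, hPx, h2] at h3
    simpa using h3
  · intro x h hx
    have d1 : HasFDerivAt (fun x : E => l (x - p)) l x :=
      l.hasFDerivAt.comp x ((hasFDerivAt_id x).sub_const p)
    have d2 : HasFDerivAt (fun x : E => b (P (x - p))) ((fderiv ℝ b (P (x - p))).comp P) x :=
      ((hb.differentiable (by simp) _).hasFDerivAt).comp x
        (P.hasFDerivAt.comp x ((hasFDerivAt_id x).sub_const p))
    have d3 := (hasFDerivAt_id x).sub ((d2.mul (d1.add (d1.neg.exp))).smul_const v)
    have d4 : HasFDerivAt ψ _ x := d3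
    rw [d4.fderiv] at hx
    replace hx : h - (b (P (x - p)) * (l h + Real.exp (-l (x - p)) * -l h) +
        (l (x - p) + Real.exp (-l (x - p))) * fderiv ℝ b (P (x - p)) (P h)) • v = 0 := hx
    -- A kernel vector is parallel to `v`, a direction in which the bump is constant, so only the
    -- positive factor `1 - β + βe` remains.
    have hPh : P h = 0 := by simpa [hPv] using congrArg P hx
    rw [hPh, map_zero, mul_zero, add_zero] at hx
    have hb0 := b.nonneg (x := P (x - p))
    have hb1 := b.le_one (x := P (x - p))
    generalize b (P (x - p)) = β at hx hb0 hb1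
    have he := Real.exp_pos (-l (x - p))
    generalize Real.exp (-l (x - p)) = e at hx he
    have hlh : l h * (1 - β + β * e) = 0 := by
      have := congrArg l hx
      simp only [map_sub, map_smul, hlv, map_zero, smul_eq_mul] at this
      linear_combination this
    have hpos : 0 < 1 - β + β * e := by
      rcases hb0.eq_or_lt with rfl | h0
      · simp
      · linarith [mul_pos h0 he]
    have hl0 : l h = 0 := (mul_eq_zero.1 hlh).resolve_right hpos.ne'
    rw [hPx, hl0] at hPh
    simpa using hPh
  · intro t
    have : b (P (c t - p)) = 0 := b.zero_of_le_dist (by simpa using hεc t)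
    simp only [hψ, this, zero_mul, zero_smul, sub_zero]
  · intro x hx
    have h1 : P (x - p) = 0 := by rw [← hPψ, hx]; simp
    have h2 := hlψ x
    rw [hx, h1, b.one_of_mem_closedBall (Metric.mem_closedBall_self b.rIn_pos.le), sub_self,
      map_zero] at h2
    linarith [Real.exp_pos (-l (x - p))]

/-- Finitely many critical points off the curve can be removed. -/
theorem exists_submersion_of_finite (hc : IsPeriodicOrbit c T) (hE : 3 ≤ Module.finrank ℝ E)
    (k : ℕ) (G : E → ℝ) (hG : ContDiff ℝ ∞ G) (hG0 : ∀ t, G (c t) = 0)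
    (hG1 : ∀ t, fderiv ℝ G (c t) ≠ 0) (hfin : {x | fderiv ℝ G x = 0}.Finite)
    (hk : {x | fderiv ℝ G x = 0}.ncard = k) :
    ∃ G : E → ℝ, ContDiff ℝ ∞ G ∧ (∀ t, G (c t) = 0) ∧ ∀ x, fderiv ℝ G x ≠ 0 := by
  induction k using Nat.strong_induction_on generalizing G with
  | _ k ih =>
    by_cases hne : ∃ p, fderiv ℝ G p = 0
    swap
    · exact ⟨G, hG, hG0, fun x hx => hne ⟨x, hx⟩⟩
    obtain ⟨p, hp⟩ := hne
    obtain ⟨ψ, hψ, hinj, hder, hψc, hψp⟩ := hc.exists_immersion_avoiding hE (p := p)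
      (by rintro ⟨t, rfl⟩; exact hG1 t hp)
    have hcrit : ∀ x, fderiv ℝ (G ∘ ψ) x = 0 → fderiv ℝ G (ψ x) = 0 := by
      intro x hx
      rw [fderiv_comp x (hG.differentiable (by simp) _) (hψ.differentiable (by simp) _)] at hx
      have hsurj : Function.Surjective (fderiv ℝ ψ x) :=
        LinearMap.surjective_of_injective (f := (fderiv ℝ ψ x : E →ₗ[ℝ] E))
          ((injective_iff_map_eq_zero _).2 (hder x))
      ext u
      obtain ⟨u, rfl⟩ := hsurj u
      exact DFunLike.congr_fun hx u
    -- `ψ` injects the critical points of `G ∘ ψ` into those of `G` other than `p`, so their number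
    -- drops.
    have hsub : ψ '' {x | fderiv ℝ (G ∘ ψ) x = 0} ⊆ {x | fderiv ℝ G x = 0} \ {p} := by
      rintro _ ⟨x, hx, rfl⟩
      exact ⟨hcrit x hx, hψp x⟩
    have hfin' := (hfin.subset (hsub.trans Set.sdiff_subset)).of_finite_image hinj.injOn
    refine ih _ ?_ (G ∘ ψ) (hG.comp hψ) (fun t => by simp [hψc, hG0])
      (fun t h => hG1 t (by simpa [hψc] using hcrit _ h)) hfin' rfl
    rw [← hk, ← Set.ncard_image_of_injective _ hinj]
    refine (Set.ncard_le_ncard hsub (hfin.subset Set.sdiff_subset)).trans_lt ?_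
    exact Set.ncard_sdiff_singleton_lt_of_mem hp hfin

end IsPeriodicOrbit

/-! ### Sard perturbation to finitely many critical points -/

/-- A smooth cutoff function for a compact subset of an open set. -/
theorem IsCompact.exists_contDiff_cutoff {E : Type*} [NormedAddCommGroup E] [NormedSpace ℝ E]
    [FiniteDimensional ℝ E] {K O : Set E} (hK : IsCompact K) (hO : IsOpen O) (hKO : K ⊆ O) :
    ∃ χ : E → ℝ, ContDiff ℝ ∞ χ ∧ HasCompactSupport χ ∧ tsupport χ ⊆ O ∧
      (∀ᶠ x in 𝓝ˢ K, χ x = 1) ∧ ∀ x, χ x ∈ Set.Icc 0 1 := by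
  obtain ⟨L, hL, hKL, hLO⟩ := exists_compact_between hK hO hKO
  obtain ⟨χ, h1, h0, h01⟩ :=
    exists_contMDiffMap_one_nhds_of_subset_interior (n := ⊤) 𝓘(ℝ, E) hK.isClosed hKL
  have hs : tsupport χ ⊆ L := closure_minimal
    (fun x hx => by by_contra h; exact hx (h0 x h)) hL.isClosed
  exact ⟨χ, χ.contMDiff.contDiff, hL.of_isClosed_subset (isClosed_tsupport _) hs, hs.trans hLO, h1,
    h01⟩

/-- The regular values of a continuously differentiable map of a Euclidean space into itself are
dense. -/
theorem ContDiff.dense_regularValues {E : Type*} [NormedAddCommGroup E] [InnerProductSpace ℝ E]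
    [FiniteDimensional ℝ E] {Γ : E → E} (hΓ : ContDiff ℝ 1 Γ) :
    Dense {a | ∀ x, Γ x = a → (fderiv ℝ Γ x).det ≠ 0} := by
  borelize E
  have h0 : MeasureTheory.volume (Γ '' {x | (fderiv ℝ Γ x).det = 0}) = 0 :=
    MeasureTheory.addHaar_image_eq_zero_of_det_fderivWithin_eq_zero _
      (fun x _ => (hΓ.differentiable (by simp) x).hasFDerivAt.hasFDerivWithinAt) fun x hx => hx
  refine (MeasureTheory.Measure.dense_of_ae
    (MeasureTheory.measure_eq_zero_iff_ae_notMem.1 h0)).mono ?_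
  intro a ha x hx h
  exact ha ⟨x, h, hx⟩

namespace IsPeriodicOrbit

variable {E : Type*} [NormedAddCommGroup E] [InnerProductSpace ℝ E] [FiniteDimensional ℝ E]
  {c : ℝ → E} {T : ℝ}

/-- In dimension at least three, the curve has a nonvanishing normal field. -/
theorem exists_normal_field (hc : IsPeriodicOrbit c T) (hE : 3 ≤ Module.finrank ℝ E) :
    ∃ w : ℝ → E, ContDiff ℝ ∞ w ∧ (∀ t t', c t = c t' → w t = w t') ∧
      (∀ t, ⟪w t, deriv c t⟫ = 0) ∧ ∀ t, w t ≠ 0 := by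
  -- Take `e` outside the two-parameter cone of tangent vectors; its normal component, scaled by the
  -- squared speed, never vanishes.
  have hd : Dense (Set.range fun q : ℝ × ℝ => q.2 • deriv c q.1)ᶜ := by
    refine ContDiff.dense_compl_range_of_finrank_lt_finrank ?_ (by simp; omega)
    exact contDiff_snd.smul ((hc.contDiff_deriv.comp contDiff_fst).of_le (by simp))
  obtain ⟨e, he⟩ := hd.nonempty
  refine ⟨fun t => ⟪deriv c t, deriv c t⟫ • e - ⟪e, deriv c t⟫ • deriv c t, ?_, ?_, ?_, ?_⟩
  · have h := hc.contDiff_deriv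
    exact ((h.inner ℝ h).smul contDiff_const).sub ((contDiff_const.inner ℝ h).smul h)
  · intro t t' h
    simp only [hc.deriv_eq h]
  · intro t
    simp only [inner_sub_left, inner_smul_left, RCLike.conj_to_real]
    ring
  · intro t h
    have h0 : ⟪deriv c t, deriv c t⟫ ≠ 0 := inner_self_ne_zero.2 (hc.deriv_ne t)
    refine he ⟨(t, ⟪deriv c t, deriv c t⟫⁻¹ * ⟪e, deriv c t⟫), ?_⟩
    show _ • deriv c t = e
    rw [mul_smul, ← sub_eq_zero.1 h, smul_smul, inv_mul_cancel₀ h0, one_smul]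

/-- In dimension at least three, the curve is in the zero level of a function which is regular
along the curve and has finitely many critical points. -/
theorem exists_finite_critical (hc : IsPeriodicOrbit c T) (hE : 3 ≤ Module.finrank ℝ E) :
    ∃ G : E → ℝ, ContDiff ℝ ∞ G ∧ (∀ t, G (c t) = 0) ∧ (∀ t, fderiv ℝ G (c t) ≠ 0) ∧
      {x | fderiv ℝ G x = 0}.Finite := by
  have hinj : ∀ a : E, innerSL ℝ a = 0 → a = 0 := fun a ha => by
    have := DFunLike.congr_fun ha a
    simpa using this
  obtain ⟨w, hw, hwc, hworth, hw0⟩ := hc.exists_normal_field hE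
  obtain ⟨F, hF, hFc⟩ := hc.exists_gradient_extension hw hwc hworth
  obtain ⟨χ, hχ, hχK, -, hχ1, -⟩ :=
    hc.isCompact_range.exists_contDiff_cutoff isOpen_univ (Set.subset_univ _)
  -- Any nonzero vector would serve: it only makes `G₀` linear without critical points off the
  -- support of `χ`.
  set e := w 0
  set G₀ : E → ℝ := fun x => χ x * F x + (1 - χ x) * ⟪e, x⟫ with hG₀def
  have hG₀ : ContDiff ℝ ∞ G₀ :=
    (hχ.mul hF).add ((contDiff_const.sub hχ).mul (contDiff_const.inner ℝ contDiff_id))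
  have hG₀c : ∀ t, G₀ =ᶠ[𝓝 (c t)] F := fun t => by
    filter_upwards [hχ1.filter_mono (nhds_le_nhdsSet (Set.mem_range_self t))] with x hx
    simp [hG₀def, hx]
  have hG₀d : ∀ t, fderiv ℝ G₀ (c t) ≠ 0 := fun t h => by
    rw [(hG₀c t).fderiv_eq, (hFc t).2.fderiv] at h
    exact hw0 t (hinj _ h)
  have hG₀o : ∀ x ∉ tsupport χ, fderiv ℝ G₀ x = innerSL ℝ e := fun x hx => by
    have : G₀ =ᶠ[𝓝 x] innerSL ℝ e := by
      filter_upwards [notMem_tsupport_iff_eventuallyEq.1 hx] with z hz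
      simp [hG₀def, hz]
    rw [this.fderiv_eq, ContinuousLinearMap.fderiv]
  have hdG₀ : Continuous (fderiv ℝ G₀) := hG₀.continuous_fderiv (by simp)
  obtain ⟨η, hη, hηK, hηO, hη1, -⟩ := hc.isCompact_range.exists_contDiff_cutoff
    (O := {x | fderiv ℝ G₀ x ≠ 0}) (isOpen_ne_fun hdG₀ continuous_const)
    (by rintro _ ⟨t, rfl⟩; exact hG₀d t)
  -- The differential of `G₀ - (1 - η)⟪a, ·⟫`. As `η = 1` near the curve, the perturbation is
  -- invisible there.
  set D : E → E → E →L[ℝ] ℝ := fun a x =>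
    fderiv ℝ G₀ x - ((1 - η x) • innerSL ℝ a - ⟪a, x⟫ • fderiv ℝ η x) with hD
  have hDcont : Continuous fun q : E × E => D q.1 q.2 := by
    have h1 : Continuous (fderiv ℝ η) := hη.continuous_fderiv (by simp)
    have h2 := hη.continuous
    simp only [hD]
    fun_prop
  have hGd : ∀ a x, HasFDerivAt (fun x => G₀ x - (1 - η x) * ⟪a, x⟫) (D a x) x := fun a x => by
    have h1 := (hG₀.differentiable (by simp) x).hasFDerivAt
    have h2 := (hη.differentiable (by simp) x).hasFDerivAt
    refine (h1.sub ((h2.const_sub 1).mul (innerSL ℝ a).hasFDerivAt)).congr_fderiv ?_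
    ext v
    simp [hD]
    ring
  have hsmall : ∀ᶠ a in 𝓝 (0 : E), ∀ x ∈ tsupport η, D a x ≠ 0 := by
    refine hηK.isCompact.eventually_forall_of_forall_eventually fun x hx => ?_
    refine hDcont.continuousAt.eventually_ne ?_
    simpa [hD] using hηO hx
  have hsmall' : ∀ᶠ a in 𝓝 (0 : E), a ≠ e :=
    continuousAt_id.eventually_ne (hw0 0).symm
  have hΓ : ContDiff ℝ 1 (gradient G₀) :=
    (InnerProductSpace.toDual ℝ E).symm.contDiff.comp
      ((contDiff_infty_iff_fderiv.1 hG₀).2.of_le (by simp))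
  -- Small `a` creates no critical points on the support of `η`; off it they solve `∇G₀ = a` and are
  -- nondegenerate since `a` is a regular value; `a ≠ e` confines them to the support of `χ`.
  obtain ⟨a, ⟨hreg, ha, hae⟩⟩ :=
    hΓ.dense_regularValues.inter_nhds_nonempty (hsmall.and hsmall')
  have hfd : ∀ x, fderiv ℝ (fun x => G₀ x - (1 - η x) * ⟪a, x⟫) x = D a x :=
    fun x => (hGd a x).fderiv
  have hout : ∀ x ∉ tsupport η, D a x = fderiv ℝ G₀ x - innerSL ℝ a := fun x hx => by
    have h1 : η x = 0 := image_eq_zero_of_notMem_tsupport hx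
    have h2 : fderiv ℝ η x = 0 := by
      rw [(notMem_tsupport_iff_eventuallyEq.1 hx).fderiv_eq, fderiv_zero]; rfl
    simp [hD, h1, h2]
  refine ⟨fun x => G₀ x - (1 - η x) * ⟪a, x⟫, ?_, ?_, ?_, ?_⟩
  · exact hG₀.sub ((contDiff_const.sub hη).mul (contDiff_const.inner ℝ contDiff_id))
  · intro t
    have h1 : η (c t) = 1 := hη1.self_of_nhdsSet _ ⟨t, rfl⟩
    simp [(hG₀c t).self_of_nhds, (hFc t).1, h1]
  · intro t
    rw [hfd]
    refine ha _ (subset_tsupport _ ?_)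
    have h1 : η (c t) = 1 := hη1.self_of_nhdsSet _ ⟨t, rfl⟩
    simp [h1]
  · simp only [hfd]
    have hZc : IsClosed {x | D a x = 0} :=
      isClosed_eq (hDcont.comp (continuous_const.prodMk continuous_id)) continuous_const
    have hZ : {x | D a x = 0} ⊆ tsupport χ := by
      intro x hx
      by_contra h
      have h1 : x ∉ tsupport η := fun h => ha x h hx
      rw [Set.mem_ofPred_eq, hout x h1, hG₀o x h, ← map_sub] at hx
      exact hae (sub_eq_zero.1 (hinj _ hx)).symm
    -- Infinitely many critical points in a compact set would accumulate at one of them, but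
    -- nondegenerate ones are isolated.
    by_contra hinf
    obtain ⟨x, -, hx⟩ := Set.Infinite.exists_accPt_of_subset_isCompact hinf hχK.isCompact hZ
    have hxZ : x ∈ {x | D a x = 0} := hZc.closure_subset
      (mem_closure_iff_clusterPt.2 hx.clusterPt)
    have hxη : x ∉ tsupport η := fun h => ha x h hxZ
    have hgrad : ∀ z ∉ tsupport η, D a z = 0 → gradient G₀ z = a := by
      intro z hz h
      rw [hout z hz, sub_eq_zero] at h
      simp only [gradient, h]
      exact (InnerProductSpace.toDual ℝ E).symm_apply_apply a
    have hdet := hreg x (hgrad x hxη hxZ)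
    have hker : LinearMap.ker (fderiv ℝ (gradient G₀) x : E →ₗ[ℝ] E) = ⊥ := by
      by_contra h
      exact hdet (LinearMap.det_eq_zero_iff_ker_ne_bot.2 h)
    have hne := (hΓ.differentiable (by simp) x).hasFDerivAt.eventually_ne (c := a)
      (by
        obtain ⟨K, -, hK⟩ := LinearMap.exists_antilipschitzWith _ hker
        exact ⟨K, hK⟩)
    have hη' : ∀ᶠ z in 𝓝[≠] x, z ∉ tsupport η :=
      mem_nhdsWithin_of_mem_nhds ((isClosed_tsupport η).isOpen_compl.mem_nhds hxη)
    obtain ⟨z, h1, h2, h3⟩ :=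
      ((accPt_iff_frequently_nhdsNE.1 hx).and_eventually (hne.and hη')).exists
    exact h2 (hgrad z h3 h1)

/-- In dimension at least three, the curve is in the zero level of a submersion. -/
theorem exists_submersion (hc : IsPeriodicOrbit c T) (hE : 3 ≤ Module.finrank ℝ E) :
    ∃ G : E → ℝ, ContDiff ℝ ∞ G ∧ (∀ t, G (c t) = 0) ∧ ∀ x, fderiv ℝ G x ≠ 0 := by
  obtain ⟨G, hG, h0, h1, hfin⟩ := hc.exists_finite_critical hE
  exact hc.exists_submersion_of_finite hE _ G hG h0 h1 hfin rfl

end IsPeriodicOrbit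

/-! ### Consequences of the differential equation and of unknottedness -/

/-- A nonconstant periodic solution of an autonomous system is a periodic orbit. -/
theorem IsSolutionIn.isPeriodicOrbit {n : ℕ} {U : Set (EuclideanSpace ℝ (Fin n))} (hU : IsOpen U)
    {f : EuclideanSpace ℝ (Fin n) → EuclideanSpace ℝ (Fin n)} (hf : ContDiffOn ℝ ∞ f U)
    {y : ℝ → EuclideanSpace ℝ (Fin n)} (hy : IsSolutionIn U f y) {T : ℝ} (hT : 0 < T)
    (hper : Function.Periodic y T) (hne : ¬ (Set.range y).Subsingleton) :
    IsPeriodicOrbit y T := by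
  have hcont : Continuous y := continuous_iff_continuousAt.2 fun t => (hy t).2.continuousAt
  have hcompact : IsCompact (Set.range y) := by
    rw [← hper.image_Icc hT 0]
    exact isCompact_Icc.image hcont
  -- On the compact orbit `f` is Lipschitz, which gives uniqueness among solutions staying on the
  -- orbit.
  obtain ⟨K, hK⟩ : ∃ K, LipschitzOnWith K f (Set.range y) := by
    refine LocallyLipschitzOn.exists_lipschitzOnWith_of_compact hcompact ?_
    rintro _ ⟨t, rfl⟩
    obtain ⟨K, s, hs, h⟩ :=
      ((hf.contDiffAt (hU.mem_nhds (hy t).1)).of_le (by simp)).exists_lipschitzOnWith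
    exact ⟨K, s, mem_nhdsWithin_of_mem_nhds hs, h⟩
  have hshift : ∀ t s, HasDerivAt (fun s => y (t + s)) (f (y (t + s))) s := fun t s =>
    (hy (t + s)).2.comp_const_add t s
  have huniq : ∀ a b : ℝ → EuclideanSpace ℝ (Fin n), (∀ s, HasDerivAt a (f (a s)) s) →
      (∀ s, HasDerivAt b (f (b s)) s) → (∀ s, a s ∈ Set.range y) → (∀ s, b s ∈ Set.range y) →
      a 0 = b 0 → a = b := fun a b ha hb ha' hb' h0 =>
    ODE_solution_unique_univ (v := fun _ => f) (s := fun _ => Set.range y) (K := K) (t₀ := 0)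
      (fun _ => hK) (fun s => ⟨ha s, ha' s⟩) (fun s => ⟨hb s, hb' s⟩) h0
  refine ⟨?_, hT, hper, ?_, ?_⟩
  · rw [contDiff_infty]
    intro m
    induction m with
    | zero => exact contDiff_zero.2 hcont
    | succ m ih =>
      push_cast
      refine contDiff_succ_iff_deriv.2 ⟨fun t => (hy t).2.differentiableAt,
        fun h => absurd h (by simp), ?_⟩
      rw [show deriv y = f ∘ y from funext fun t => (hy t).2.deriv]
      exact ContDiffOn.comp_contDiff (hf.of_le (by exact_mod_cast le_top)) ih fun t => (hy t).1
  -- If the velocity vanished, the constant curve would be a solution with the same initial value.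
  · intro t ht
    rw [(hy t).2.deriv] at ht
    have h := huniq (fun s => y (t + s)) (fun _ => y t) (hshift t)
      (fun s => by rw [ht]; exact hasDerivAt_const _ _) (fun s => ⟨_, rfl⟩) (fun s => ⟨_, rfl⟩)
      (by simp)
    have h' : ∀ s, y s = y t := fun s => by simpa using congrFun h (s - t)
    refine hne ?_
    rintro _ ⟨s, rfl⟩ _ ⟨s', rfl⟩
    rw [h', h' s']
  · intro t t' s h
    exact congrFun (huniq (fun s => y (t + s)) (fun s => y (t' + s)) (hshift t) (hshift t')
      (fun s => ⟨_, rfl⟩) (fun s => ⟨_, rfl⟩) (by simpa using h)) s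

/-- An unknotted circle lives in dimension at least two. -/
theorem IsUnknotted.two_le {n : ℕ} {K : Set (EuclideanSpace ℝ (Fin n))} (hK : IsUnknotted K) :
    2 ≤ n := by
  by_contra hn
  obtain ⟨h, hh⟩ := hK
  -- For `n ≤ 1` no coordinate is constrained, yet the image of `K` misses the pole.
  have h1 : trivialKnot n = Set.univ :=
    Set.eq_univ_of_forall fun x i hi => absurd i.isLt (by omega)
  have : Fact (Module.finrank ℝ (EuclideanSpace ℝ (Fin (n + 1))) = n + 1) :=
    ⟨finrank_euclideanSpace_fin⟩
  have h2 : h (northPole n) ∈ h '' (toUnitSphere n '' K) := by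
    rw [hh, h1]; trivial
  obtain ⟨x, -, hx⟩ := (h.injective.mem_set_image).1 h2
  have h3 : toUnitSphere n x ∈ (stereographic' n (northPole n)).source :=
    (stereographic' n (northPole n)).map_target (by simp)
  rw [stereographic'_source, hx] at h3
  exact h3 rfl

/-- An unknotted circle has more than one point. -/
theorem IsUnknotted.not_subsingleton {n : ℕ} {K : Set (EuclideanSpace ℝ (Fin n))}
    (hK : IsUnknotted K) : ¬ K.Subsingleton := by
  intro hs
  have hn := hK.two_le
  obtain ⟨h, hh⟩ := hK
  have h1 : (trivialKnot n).Subsingleton := hh ▸ (hs.image _).image _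
  let e : ∀ i : Fin (n + 1), UnitSphere n := fun i => ⟨EuclideanSpace.single i 1, by simp⟩
  have he : ∀ i : Fin (n + 1), (i : ℕ) < 2 → e i ∈ trivialKnot n := fun i hi j hj => by
    have : j ≠ i := by rintro rfl; omega
    simp [e, this]
  have h01 := h1 (he ⟨0, by omega⟩ (by simp)) (he ⟨1, by omega⟩ (by simp))
  have := congrArg (fun z : UnitSphere n =>
    (z : EuclideanSpace ℝ (Fin (n + 1))) ⟨0, by omega⟩) h01
  simp [e] at this

/-! ### Dimension at least four: projecting the orbit -/

namespace IsPeriodicOrbit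

variable {E : Type*} [NormedAddCommGroup E] [InnerProductSpace ℝ E] [FiniteDimensional ℝ E]
  {c : ℝ → E} {T : ℝ}

/-- In dimension at least four, the curve projects injectively and immersively along some
direction. -/
theorem exists_projection_direction (hc : IsPeriodicOrbit c T) (hE : 4 ≤ Module.finrank ℝ E) :
    ∃ v : E, ‖v‖ = 1 ∧ (∀ t (s : ℝ), deriv c t ≠ s • v) ∧
      ∀ t t' (s : ℝ), c t - c t' = s • v → c t = c t' := by
  -- Tangent and secant directions sweep out images of two- and three-dimensional spaces, too small
  -- to fill dimension four.
  have hd : Dense ((Set.range fun q : ℝ × ℝ => q.2 • deriv c q.1) ∪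
      Set.range fun q : ℝ × ℝ × ℝ => q.2.2 • (c q.1 - c q.2.1))ᶜ := by
    refine dense_compl_of_dimH_lt_finrank ?_
    rw [dimH_union]
    have h1 : ContDiff ℝ 1 fun q : ℝ × ℝ => q.2 • deriv c q.1 :=
      contDiff_snd.smul ((hc.contDiff_deriv.comp contDiff_fst).of_le (by simp))
    have hc1 : ContDiff ℝ 1 c := hc.contDiff.of_le (by simp)
    have h2 : ContDiff ℝ 1 fun q : ℝ × ℝ × ℝ => q.2.2 • (c q.1 - c q.2.1) :=
      (contDiff_snd.comp contDiff_snd).smul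
        ((hc1.comp contDiff_fst).sub (hc1.comp (contDiff_fst.comp contDiff_snd)))
    refine max_lt (h1.dimH_range_le.trans_lt (Nat.cast_lt.2 ?_))
      (h2.dimH_range_le.trans_lt (Nat.cast_lt.2 ?_))
    · simp; omega
    · simp; omega
  obtain ⟨v, hv⟩ := hd.nonempty
  have hv0 : v ≠ 0 := by
    rintro rfl
    exact hv (Or.inl ⟨(0, 0), by simp⟩)
  have hv1 : ‖v‖ ≠ 0 := by simpa using hv0
  refine ⟨‖v‖⁻¹ • v, by simp [norm_smul, hv1], ?_, ?_⟩
  · intro t s h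
    have hs : s ≠ 0 := by
      rintro rfl
      exact hc.deriv_ne t (by simpa using h)
    refine hv (Or.inl ⟨(t, ‖v‖ * s⁻¹), ?_⟩)
    show (‖v‖ * s⁻¹) • deriv c t = v
    rw [h, smul_smul, smul_smul, show ‖v‖ * s⁻¹ * s * ‖v‖⁻¹ = 1 by field_simp, one_smul]
  · intro t t' s h
    by_contra hne
    have hs : s ≠ 0 := by
      rintro rfl
      exact hne (by simpa [sub_eq_zero] using h)
    refine hv (Or.inr ⟨(t, t', ‖v‖ * s⁻¹), ?_⟩)
    show (‖v‖ * s⁻¹) • (c t - c t') = v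
    rw [h, smul_smul, smul_smul, show ‖v‖ * s⁻¹ * s * ‖v‖⁻¹ = 1 by field_simp, one_smul]

/-- In dimension at least four, there are a unit vector `v` and a nonvanishing vector field `Y`
orthogonal to `v` and invariant under translations by multiples of `v`, such that the velocity of
the curve is `Y` up to a multiple of `v`. -/
theorem exists_transverse_field (hc : IsPeriodicOrbit c T) (hE : 4 ≤ Module.finrank ℝ E) :
    ∃ (v : E) (Y : E → E), ‖v‖ = 1 ∧ ContDiff ℝ ∞ Y ∧ (∀ x, Y x ≠ 0) ∧ (∀ x, ⟪v, Y x⟫ = 0) ∧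
      (∀ x (s : ℝ), Y (x + s • v) = Y x) ∧
      ∀ t, deriv c t = ⟪v, deriv c t⟫ • v + Y (c t) := by
  obtain ⟨v, hv1, hvd, hvi⟩ := hc.exists_projection_direction hE
  set P : E →L[ℝ] E := ContinuousLinearMap.id ℝ E - (innerSL ℝ v).smulRight v with hP
  have hPx : ∀ z, P z = z - ⟪v, z⟫ • v := fun z => by simp [hP]
  have hvv : ⟪v, v⟫ = 1 := by rw [real_inner_self_eq_norm_sq, hv1, one_pow]
  have hPv : P v = 0 := by rw [hPx, hvv, one_smul, sub_self]
  have hvP : ∀ z, ⟪v, P z⟫ = 0 := fun z => by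
    rw [hPx, inner_sub_right, inner_smul_right, hvv, mul_one, sub_self]
  have hPP : ∀ z, P (P z) = P z := fun z => by rw [hPx (P z), hvP]; simp
  have hP0 : ∀ z, P z = 0 → z = ⟪v, z⟫ • v := fun z hz => by rwa [hPx, sub_eq_zero] at hz
  have hder : ∀ t, HasDerivAt (fun t => P (c t)) (P (deriv c t)) t := fun t =>
    P.hasFDerivAt.comp_hasDerivAt t (hc.hasDerivAt t)
  have hinj : ∀ t t', P (c t) = P (c t') → c t = c t' := fun t t' h =>
    hvi t t' _ (hP0 _ (by rw [map_sub, h, sub_self]))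
  have hd : IsPeriodicOrbit (fun t => P (c t)) T :=
    { contDiff := P.contDiff.comp hc.contDiff
      pos := hc.pos
      periodic := fun t => congrArg P (hc.periodic t)
      deriv_ne := fun t h => by
        rw [(hder t).deriv] at h
        exact hvd t _ (hP0 _ h)
      shift := fun t t' s h => congrArg P (hc.shift t t' s (hinj _ _ h)) }
  obtain ⟨Z, hZ, hZc⟩ := hd.exists_extension (φ := fun t => P (deriv c t))
    (P.contDiff.comp hc.contDiff_deriv) fun t t' h => congrArg P (hc.deriv_eq (hinj _ _ h))
  -- Choose `w` outside every span of `v` and a velocity, a three-parameter family; then `P w` is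
  -- never a multiple of a projected velocity.
  have hdense : Dense (Set.range fun q : ℝ × ℝ × ℝ => q.2.1 • deriv c q.1 + q.2.2 • v)ᶜ := by
    refine ContDiff.dense_compl_range_of_finrank_lt_finrank ?_ (by simp; omega)
    have hc1 : ContDiff ℝ 1 (deriv c) := hc.contDiff_deriv.of_le (by simp)
    exact ((contDiff_fst.comp contDiff_snd).smul (hc1.comp contDiff_fst)).add
      ((contDiff_snd.comp contDiff_snd).smul contDiff_const)
  obtain ⟨w, hw⟩ := hdense.nonempty
  have hwne : ∀ t (s : ℝ), P w ≠ s • P (deriv c t) := fun t s h => by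
    have h1 := hP0 (w - s • deriv c t) (by rw [map_sub, map_smul, h, sub_self])
    refine hw ⟨(t, s, ⟪v, w - s • deriv c t⟫), ?_⟩
    show s • deriv c t + ⟪v, w - s • deriv c t⟫ • v = w
    rw [← h1]; abel
  have hPw : P w ≠ 0 := fun h => hwne 0 0 (by simpa using h)
  -- the convex combinations of `P (Z z)` and `P w` do not vanish near the curve
  set O : Set E := {z | ∀ r ∈ Set.Icc (0 : ℝ) 1, r • P (Z z) + (1 - r) • P w ≠ 0} with hOdef
  have hO : IsOpen O := by
    rw [isOpen_iff_eventually]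
    intro z hz
    refine isCompact_Icc.eventually_forall_of_forall_eventually fun r hr => ?_
    have hcts : Continuous fun q : E × ℝ => q.2 • P (Z q.1) + (1 - q.2) • P w := by
      have := hZ.continuous
      fun_prop
    exact hcts.continuousAt.eventually_ne (hz r hr)
  have hcO : Set.range (fun t => P (c t)) ⊆ O := by
    rintro _ ⟨t, rfl⟩ r hr h
    rw [hZc, hPP] at h
    rcases eq_or_ne r 1 with rfl | hr1
    · exact hvd t _ (hP0 _ (by simpa using h))
    · have h1 : 1 - r ≠ 0 := sub_ne_zero.2 hr1.symm
      refine hwne t (-((1 - r)⁻¹ * r)) ?_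
      have h2 := congrArg (fun z => (1 - r)⁻¹ • z) h
      simp only [smul_add, smul_smul, inv_mul_cancel₀ h1, one_smul, smul_zero] at h2
      rw [neg_smul]
      exact (neg_eq_of_add_eq_zero_right h2).symm
  obtain ⟨χ, hχ, -, hχO, hχ1, hχ01⟩ := hd.isCompact_range.exists_contDiff_cutoff hO hcO
  have hχP : ContDiff ℝ ∞ fun x => χ (P x) := hχ.comp P.contDiff
  -- Interpolates between the projected velocity near the curve and the constant `P w` away from it.
  -- Inner `P` gives invariance along `v`, outer `P` orthogonality to `v`.
  refine ⟨v, fun x => χ (P x) • P (Z (P x)) + (1 - χ (P x)) • P w, hv1, ?_, ?_, ?_, ?_, ?_⟩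
  · exact (hχP.smul (P.contDiff.comp (hZ.comp P.contDiff))).add
      ((contDiff_const.sub hχP).smul contDiff_const)
  · intro x
    by_cases hx : χ (P x) = 0
    · simpa [hx] using hPw
    · exact hχO (subset_tsupport _ hx) _ (hχ01 _)
  · intro x
    simp [inner_add_right, inner_smul_right, hvP]
  · intro x s
    simp [hPv]
  · intro t
    have h1 : χ (P (c t)) = 1 := hχ1.self_of_nhdsSet _ ⟨t, rfl⟩
    simp only [h1, hZc, hPP, one_smul, sub_self, zero_smul, add_zero]
    rw [hPx]; abel

end IsPeriodicOrbit

section PartialDeriv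

variable {n : ℕ} {F : EuclideanSpace ℝ (Fin n) → ℝ}

theorem ContDiff.partialDeriv (hF : ContDiff ℝ ∞ F) (l : Fin n) :
    ContDiff ℝ ∞ (partialDeriv F l) :=
  (contDiff_infty_iff_fderiv.1 hF).2.clm_apply contDiff_const

theorem fderiv_eq_sum_partialDeriv (x u : EuclideanSpace ℝ (Fin n)) :
    fderiv ℝ F x u = ∑ l, partialDeriv F l x * u l := by
  have h : u = ∑ l, u l • EuclideanSpace.single l (1 : ℝ) := by
    ext i
    simp [Finset.sum_apply, Pi.single_apply]
  conv_lhs => rw [h]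
  simp [partialDeriv, mul_comm]

theorem ContDiff.partialDeriv_comm (hF : ContDiff ℝ ∞ F) (k l : Fin n)
    (x : EuclideanSpace ℝ (Fin n)) :
    _root_.partialDeriv (_root_.partialDeriv F k) l x =
      _root_.partialDeriv (_root_.partialDeriv F l) k x := by
  have h1 : Differentiable ℝ (fderiv ℝ F) :=
    (contDiff_infty_iff_fderiv.1 hF).2.differentiable (by simp)
  have h2 : ∀ k l, _root_.partialDeriv (_root_.partialDeriv F k) l x =
      fderiv ℝ (fderiv ℝ F) x (EuclideanSpace.single l 1) (EuclideanSpace.single k 1) := by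
    intro k l
    show fderiv ℝ (fun z => fderiv ℝ F z (EuclideanSpace.single k 1)) x _ = _
    rw [fderiv_clm_apply (h1 x) (differentiableAt_const _)]
    simp
  rw [h2, h2]
  exact (hF.contDiffAt.isSymmSndFDerivAt
    (by simpa using (WithTop.coe_le_coe.2 le_top : ((2 : ℕ∞) : WithTop ℕ∞) ≤ ∞))).eq _ _

end PartialDeriv

/-! ### From a Poisson structure to a Hamiltonian -/

/-- If a rank-two Poisson structure has the orbit tangent to its symplectic leaves, with smooth
covectors realizing the velocity, then the orbit solves a Poisson system. -/
theorem IsPoissonMatrixOn.exists_hamiltonian {n : ℕ} {U : Set (EuclideanSpace ℝ (Fin n))}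
    {f : EuclideanSpace ℝ (Fin n) → EuclideanSpace ℝ (Fin n)}
    {y : ℝ → EuclideanSpace ℝ (Fin n)} {T : ℝ} (hy : IsSolutionIn U f y)
    (hc : IsPeriodicOrbit y T) {B : EuclideanSpace ℝ (Fin n) → Matrix (Fin n) (Fin n) ℝ}
    (hB : IsPoissonMatrixOn Set.univ B) (hrank : ∀ x, (B x).rank = 2)
    {w : ℝ → EuclideanSpace ℝ (Fin n)} (hw : ContDiff ℝ ∞ w)
    (hwc : ∀ t t', y t = y t' → w t = w t')
    (hBw : ∀ t, B (y t) *ᵥ (w t).ofLp = (deriv y t).ofLp) :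
    ∃ (H : EuclideanSpace ℝ (Fin n) → ℝ)
      (B : EuclideanSpace ℝ (Fin n) → Matrix (Fin n) (Fin n) ℝ),
      ContDiffOn ℝ ∞ H U ∧ IsPoissonMatrixOn U B ∧ (∀ x ∈ U, (B x).rank = 2) ∧
      IsSolutionIn U (poissonField B H) y := by
  have horth : ∀ t, ⟪w t, deriv y t⟫ = 0 := by
    intro t
    have h1 : ⟪w t, deriv y t⟫ = (w t).ofLp ⬝ᵥ B (y t) *ᵥ (w t).ofLp := by
      rw [hBw, EuclideanSpace.inner_eq_star_dotProduct, dotProduct_comm]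
      simp
    have h2 : (B (y t))ᵀ = -B (y t) := by
      ext i j
      exact hB.skew _ trivial j i
    have h3 : (w t).ofLp ⬝ᵥ B (y t) *ᵥ (w t).ofLp = -((w t).ofLp ⬝ᵥ B (y t) *ᵥ (w t).ofLp) := by
      conv_lhs => rw [Matrix.dotProduct_mulVec, ← Matrix.mulVec_transpose, h2, Matrix.neg_mulVec,
        neg_dotProduct, dotProduct_comm]
    rw [h1]
    linarith
  obtain ⟨H, hH, hHc⟩ := hc.exists_gradient_extension hw hwc horth
  refine ⟨H, B, hH.contDiffOn, ⟨fun i j => (hB.smooth i j).mono (Set.subset_univ _),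
    fun x _ => hB.skew x trivial, fun x _ => hB.jacobi x trivial⟩, fun x _ => hrank x,
    fun t => ⟨(hy t).1, ?_⟩⟩
  have hg : gradient H (y t) = w t :=
    (hasGradientAt_iff_hasFDerivAt.2 (hHc t).2).gradient
  have hfield : poissonField B H (y t) = deriv y t := by
    rw [poissonField, hg, hBw]
  rw [hfield]
  exact hc.hasDerivAt t

/-! ### Poisson structures `v ∧ Y` -/

/-- The bivector `v ∧ w` as a skew-symmetric matrix. -/
def wedgeMatrix {n : ℕ} (v w : Fin n → ℝ) : Matrix (Fin n) (Fin n) ℝ :=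
  Matrix.vecMulVec v w - Matrix.vecMulVec w v

theorem wedgeMatrix_apply {n : ℕ} (v w : Fin n → ℝ) (i j : Fin n) :
    wedgeMatrix v w i j = v i * w j - w i * v j := by
  simp [wedgeMatrix, Matrix.vecMulVec_apply]

theorem wedgeMatrix_mulVec {n : ℕ} (v w u : Fin n → ℝ) :
    wedgeMatrix v w *ᵥ u = (w ⬝ᵥ u) • v - (v ⬝ᵥ u) • w := by
  simp [wedgeMatrix, Matrix.sub_mulVec, Matrix.vecMulVec_mulVec]

/-- Orthogonality makes `v` and `w` independent and exhibits preimages of both (multiples of `w` and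
`v`), so the range is their span. -/
theorem rank_wedgeMatrix {n : ℕ} {v w : Fin n → ℝ} (hv : v ≠ 0) (hw : w ≠ 0) (hvw : v ⬝ᵥ w = 0) :
    (wedgeMatrix v w).rank = 2 := by
  have hvv : v ⬝ᵥ v ≠ 0 := by simpa using hv
  have hww : w ⬝ᵥ w ≠ 0 := by simpa using hw
  have hli : LinearIndependent ℝ ![v, w] := by
    rw [LinearIndependent.pair_iff]
    intro s t h
    have h1 := congrArg (v ⬝ᵥ ·) h
    have h2 := congrArg (w ⬝ᵥ ·) h
    simp only [dotProduct_add, dotProduct_smul, hvw, dotProduct_comm w v, dotProduct_zero,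
      smul_eq_mul, mul_zero, add_zero, zero_add, mul_eq_zero, hvv, hww, or_false] at h1 h2
    exact ⟨h1, h2⟩
  have hspan : Submodule.span ℝ (Set.range ![v, w]) =
      LinearMap.range (wedgeMatrix v w).mulVecLin := by
    rw [Matrix.range_cons, Matrix.range_cons, Matrix.range_empty, Set.union_empty]
    apply le_antisymm
    · rw [Submodule.span_le]
      rintro _ (rfl | rfl)
      · exact ⟨(w ⬝ᵥ w)⁻¹ • w, by simp [wedgeMatrix_mulVec, hvw, hww]⟩
      · exact ⟨-(v ⬝ᵥ v)⁻¹ • v, by simp [wedgeMatrix_mulVec, dotProduct_comm _ v, hvw, hvv]⟩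
    · rintro _ ⟨u, rfl⟩
      rw [Matrix.mulVecLin_apply, wedgeMatrix_mulVec]
      exact sub_mem (Submodule.smul_mem _ _ (Submodule.subset_span (by simp)))
        (Submodule.smul_mem _ _ (Submodule.subset_span (by simp)))
  rw [Matrix.rank, ← hspan, finrank_span_eq_card hli, Fintype.card_fin]

/-- If `Y` is invariant under the flow of the constant vector field `v`, then `v ∧ Y` is a Poisson
structure. -/
theorem isPoissonMatrixOn_wedgeMatrix {n : ℕ} {v : EuclideanSpace ℝ (Fin n)}
    {Y : EuclideanSpace ℝ (Fin n) → EuclideanSpace ℝ (Fin n)} (hY : ContDiff ℝ ∞ Y)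
    (hinv : ∀ x (s : ℝ), Y (x + s • v) = Y x) :
    IsPoissonMatrixOn Set.univ fun x => wedgeMatrix v.ofLp (Y x).ofLp := by
  have hYi : ∀ i, ContDiff ℝ ∞ fun x => Y x i := fun i => (contDiff_euclidean.1 hY) i
  refine ⟨fun i j => ?_, fun x _ i j => ?_, fun x _ i j k => ?_⟩
  · simp only [wedgeMatrix_apply]
    exact ((contDiff_const.mul (hYi j)).sub ((hYi i).mul contDiff_const)).contDiffOn
  · simp only [wedgeMatrix_apply]; ring
  · set D : Fin n → Fin n → ℝ := fun l j => partialDeriv (fun z => Y z j) l x with hD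
    have hpd : ∀ i j l, partialDeriv (fun z => wedgeMatrix v.ofLp (Y z).ofLp i j) l x =
        v i * D l j - D l i * v j := by
      intro i j l
      have hd : ∀ i, HasFDerivAt (fun z => Y z i) (fderiv ℝ (fun z => Y z i) x) x :=
        fun i => ((hYi i).differentiable (by simp) x).hasFDerivAt
      have h := ((hd j).const_mul (v i)).sub ((hd i).mul_const (v j))
      simp only [wedgeMatrix_apply, partialDeriv, hD]
      rw [HasFDerivAt.fderiv (f := fun z => v i * Y z j - Y z i * v j) h]
      simp [mul_comm]
    -- Invariance, infinitesimally: `Y` has zero derivative along `v`.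
    have hDv : ∀ j, ∑ l, D l j * v l = 0 := by
      intro j
      rw [← fderiv_eq_sum_partialDeriv]
      have h1 : HasDerivAt (fun s : ℝ => x + s • v) v 0 := by
        simpa using ((hasDerivAt_id (0 : ℝ)).smul_const v).const_add x
      have h2 : HasFDerivAt (fun z => Y z j) (fderiv ℝ (fun z => Y z j) x) (x + (0 : ℝ) • v) := by
        rw [zero_smul, add_zero]
        exact ((hYi j).differentiable (by simp) x).hasFDerivAt
      have h3 := h2.comp_hasDerivAt (0 : ℝ) h1
      have h4 : ((fun z => Y z j) ∘ fun s : ℝ => x + s • v) = fun _ => Y x j := by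
        ext s
        simp [hinv]
      rw [h4] at h3
      exact h3.unique (hasDerivAt_const _ _)
    -- With `A j` the derivative of `Y j` along `Y`, what survives is `-v k (v i A j - v j A i)`,
    -- whose cyclic sum is zero.
    have hsum : ∀ i j k, ∑ l, (v i * D l j - D l i * v j) * (v l * Y x k - Y x l * v k) =
        -v k * (v i * (∑ l, D l j * Y x l) - v j * ∑ l, D l i * Y x l) := by
      intro i j k
      have h1 : ∑ l, (v i * D l j - D l i * v j) * (v l * Y x k - Y x l * v k) =
          v i * Y x k * (∑ l, D l j * v l) - v j * Y x k * (∑ l, D l i * v l) +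
          -v k * (v i * (∑ l, D l j * Y x l) - v j * ∑ l, D l i * Y x l) := by
        simp only [Finset.mul_sum, ← Finset.sum_sub_distrib, ← Finset.sum_add_distrib]
        exact Finset.sum_congr rfl fun l _ => by ring
      rw [h1, hDv, hDv]
      ring
    simp only [hpd]
    simp only [wedgeMatrix_apply, Finset.sum_add_distrib, hsum]
    ring

/-- An orbit tangent to a distribution `v ∧ Y` solves a Poisson system. -/
theorem IsPeriodicOrbit.exists_poisson_of_wedge {n : ℕ} {U : Set (EuclideanSpace ℝ (Fin n))}
    {f : EuclideanSpace ℝ (Fin n) → EuclideanSpace ℝ (Fin n)}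
    {y : ℝ → EuclideanSpace ℝ (Fin n)} {T : ℝ} (hc : IsPeriodicOrbit y T)
    (hy : IsSolutionIn U f y) {v : EuclideanSpace ℝ (Fin n)}
    {Y : EuclideanSpace ℝ (Fin n) → EuclideanSpace ℝ (Fin n)} (hv : v ≠ 0)
    (hY : ContDiff ℝ ∞ Y) (hY0 : ∀ x, Y x ≠ 0) (hvY : ∀ x, ⟪v, Y x⟫ = 0)
    (hinv : ∀ x (s : ℝ), Y (x + s • v) = Y x)
    (htan : ∀ t, ∃ p q : ℝ, deriv y t = p • v + q • Y (y t)) :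
    ∃ (H : EuclideanSpace ℝ (Fin n) → ℝ)
      (B : EuclideanSpace ℝ (Fin n) → Matrix (Fin n) (Fin n) ℝ),
      ContDiffOn ℝ ∞ H U ∧ IsPoissonMatrixOn U B ∧ (∀ x ∈ U, (B x).rank = 2) ∧
      IsSolutionIn U (poissonField B H) y := by
  have hdot : ∀ a b : EuclideanSpace ℝ (Fin n), a.ofLp ⬝ᵥ b.ofLp = ⟪a, b⟫ := fun a b => by
    rw [EuclideanSpace.inner_eq_star_dotProduct, dotProduct_comm]
    simp
  have hvv : ⟪v, v⟫ ≠ 0 := inner_self_ne_zero.2 hv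
  have hYY : ∀ x, ⟪Y x, Y x⟫ ≠ 0 := fun x => inner_self_ne_zero.2 (hY0 x)
  have hYv : ∀ x, ⟪Y x, v⟫ = 0 := fun x => by rw [real_inner_comm, hvY]
  have hYy : ContDiff ℝ ∞ fun t => Y (y t) := hY.comp hc.contDiff
  have hn : ContDiff ℝ ∞ fun t => (⟪v, v⟫ * ⟪Y (y t), Y (y t)⟫)⁻¹ :=
    (contDiff_const.mul (hYy.inner ℝ hYy)).inv fun t => mul_ne_zero hvv (hYY _)
  -- Solves `⟪Y, w⟫ = p` and `⟪v, w⟫ = -q`, which is what `(v ∧ Y) w = p v + q Y` requires.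
  refine IsPoissonMatrixOn.exists_hamiltonian hy hc (isPoissonMatrixOn_wedgeMatrix hY hinv)
    (fun x => rank_wedgeMatrix ?_ ?_ ?_)
    (w := fun t => (⟪v, v⟫ * ⟪Y (y t), Y (y t)⟫)⁻¹ •
      (⟪v, deriv y t⟫ • Y (y t) - ⟪Y (y t), deriv y t⟫ • v)) ?_ ?_ ?_
  · exact fun h => hv ((WithLp.ofLp_eq_zero 2).1 h)
  · exact fun h => hY0 x ((WithLp.ofLp_eq_zero 2).1 h)
  · rw [hdot, hvY]
  · exact hn.smul (((contDiff_const.inner ℝ hc.contDiff_deriv).smul hYy).sub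
      ((hYy.inner ℝ hc.contDiff_deriv).smul contDiff_const))
  · intro t t' h
    simp only [h, hc.deriv_eq h]
  · intro t
    rw [wedgeMatrix_mulVec, hdot, hdot]
    obtain ⟨p, q, h⟩ := htan t
    have h1 : (⟪v, v⟫ * ⟪Y (y t), Y (y t)⟫)⁻¹ * (p * ⟪v, v⟫ * ⟪Y (y t), Y (y t)⟫) = p := by
      have := hYY (y t)
      field_simp
    have h2 : (⟪v, v⟫ * ⟪Y (y t), Y (y t)⟫)⁻¹ * (q * ⟪Y (y t), Y (y t)⟫ * ⟪v, v⟫) = q := by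
      have := hYY (y t)
      field_simp
    have e1 : ⟪v, deriv y t⟫ = p * ⟪v, v⟫ := by
      rw [h, inner_add_right, inner_smul_right, inner_smul_right, hvY]; ring
    have e2 : ⟪Y (y t), deriv y t⟫ = q * ⟪Y (y t), Y (y t)⟫ := by
      rw [h, inner_add_right, inner_smul_right, inner_smul_right, hYv]; ring
    rw [e1, e2]
    simp only [inner_smul_right, inner_sub_right, hvY, hYv, mul_zero, sub_zero, zero_sub, mul_neg,
      h1, h2]
    rw [h]
    simp

/-! ### Dimension three: level surfaces of a submersion -/

/-- The matrix of the cross product with a vector. -/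
def crossMatrix (a : Fin 3 → ℝ) : Matrix (Fin 3) (Fin 3) ℝ :=
  !![0, -a 2, a 1; a 2, 0, -a 0; -a 1, a 0, 0]

theorem crossMatrix_mulVec (a u : Fin 3 → ℝ) : crossMatrix a *ᵥ u = a ⨯₃ u := by
  rw [cross_apply]
  ext i
  fin_cases i <;> simp [crossMatrix, Matrix.mulVec, dotProduct, Fin.sum_univ_three] <;> ring

/-- The kernel of `a ×` is the line through `a`, so rank-nullity gives `3 - 1`. -/
theorem rank_crossMatrix {a : Fin 3 → ℝ} (ha : a ≠ 0) : (crossMatrix a).rank = 2 := by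
  have hker : LinearMap.ker (crossMatrix a).mulVecLin = Submodule.span ℝ {a} := by
    ext u
    rw [LinearMap.mem_ker, Matrix.mulVecLin_apply, crossMatrix_mulVec,
      Submodule.mem_span_singleton]
    have h := (crossProduct_ne_zero_iff_linearIndependent (v := a) (w := u)).trans
      (LinearIndependent.pair_iff' ha)
    rw [← not_iff_not, ← ne_eq, h]
    push Not
    rfl
  have h := LinearMap.finrank_range_add_finrank_ker (crossMatrix a).mulVecLin
  rw [hker, finrank_span_singleton ha] at h
  simp only [Module.finrank_fintype_fun_eq_card, Fintype.card_fin] at h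
  rw [Matrix.rank]
  omega

/-- In dimension three, the differential of a function gives a Poisson structure. -/
theorem isPoissonMatrixOn_crossMatrix {G : EuclideanSpace ℝ (Fin 3) → ℝ} (hG : ContDiff ℝ ∞ G) :
    IsPoissonMatrixOn Set.univ fun x => crossMatrix fun k => partialDeriv G k x := by
  have ha := fun k => hG.partialDeriv k
  refine ⟨fun i j => ?_, fun x _ i j => ?_, fun x _ i j k => ?_⟩
  · refine ContDiff.contDiffOn ?_
    fin_cases i <;> fin_cases j <;> simp [crossMatrix] <;>
      first | exact contDiff_const | exact ha _ | exact (ha _).neg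
  · fin_cases i <;> fin_cases j <;> simp [crossMatrix]
  · set S : Fin 3 → Fin 3 → ℝ := fun l k => partialDeriv (partialDeriv G k) l x with hS
    -- The Jacobi identity here amounts to `a · curl a = 0`, so symmetry of the Hessian suffices.
    have hsymm : ∀ k l, S k l = S l k := fun k l => hG.partialDeriv_comm l k x
    have hpd : ∀ i j l, partialDeriv (fun z => crossMatrix (fun k => partialDeriv G k z) i j) l x =
        crossMatrix (S l) i j := by
      intro i j l
      fin_cases i <;> fin_cases j <;> simp [crossMatrix, hS, partialDeriv] <;> rfl
    simp only [hpd]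
    have h1 := hsymm 1 0
    have h2 := hsymm 2 0
    have h3 := hsymm 2 1
    fin_cases i <;> fin_cases j <;> fin_cases k <;>
      simp [crossMatrix, Fin.sum_univ_three, h1, h2, h3] <;> ring

/-- In dimension three, every periodic orbit lies in a level surface of a submersion, and hence
solves a Poisson system. -/
theorem IsPeriodicOrbit.exists_poisson_of_three {U : Set (EuclideanSpace ℝ (Fin 3))}
    {f : EuclideanSpace ℝ (Fin 3) → EuclideanSpace ℝ (Fin 3)}
    {y : ℝ → EuclideanSpace ℝ (Fin 3)} {T : ℝ} (hc : IsPeriodicOrbit y T)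
    (hy : IsSolutionIn U f y) :
    ∃ (H : EuclideanSpace ℝ (Fin 3) → ℝ)
      (B : EuclideanSpace ℝ (Fin 3) → Matrix (Fin 3) (Fin 3) ℝ),
      ContDiffOn ℝ ∞ H U ∧ IsPoissonMatrixOn U B ∧ (∀ x ∈ U, (B x).rank = 2) ∧
      IsSolutionIn U (poissonField B H) y := by
  obtain ⟨G, hG, hGc, hG0⟩ := hc.exists_submersion (by simp)
  set a : EuclideanSpace ℝ (Fin 3) → Fin 3 → ℝ := fun x k => partialDeriv G k x with ha
  have ha0 : ∀ x, a x ≠ 0 := by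
    intro x h
    refine hG0 x (ContinuousLinearMap.ext fun u => ?_)
    rw [fderiv_eq_sum_partialDeriv]
    exact Finset.sum_eq_zero fun l _ => by
      rw [show partialDeriv G l x = 0 from congrFun h l, zero_mul]
  have haa : ∀ x, a x ⬝ᵥ a x ≠ 0 := fun x => by simpa using ha0 x
  have hay : ∀ t, a (y t) ⬝ᵥ (deriv y t).ofLp = 0 := by
    intro t
    have h1 := ((hG.differentiable (by simp) (y t)).hasFDerivAt).comp_hasDerivAt t (hc.hasDerivAt t)
    rw [show G ∘ y = fun _ => 0 from funext hGc] at h1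
    rw [← h1.unique (hasDerivAt_const _ _), fderiv_eq_sum_partialDeriv]
    rfl
  have has : ∀ k, ContDiff ℝ ∞ fun t => a (y t) k := fun k => (hG.partialDeriv k).comp hc.contDiff
  have hys : ∀ k, ContDiff ℝ ∞ fun t => deriv y t k := fun k =>
    (contDiff_euclidean.1 hc.contDiff_deriv) k
  -- Since `a ⊥ ẏ`, the double product `a × (a × ẏ)` is `-|a|² ẏ`, which dictates `w`.
  refine IsPoissonMatrixOn.exists_hamiltonian hy hc (isPoissonMatrixOn_crossMatrix hG)
    (fun x => rank_crossMatrix (ha0 x))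
    (w := fun t => WithLp.toLp 2 (-(a (y t) ⬝ᵥ a (y t))⁻¹ • (a (y t) ⨯₃ (deriv y t).ofLp)))
    ?_ ?_ ?_
  · rw [contDiff_euclidean]
    intro i
    have hn : ContDiff ℝ ∞ fun t => -(a (y t) ⬝ᵥ a (y t))⁻¹ :=
      ((ContDiff.sum fun k _ => (has k).mul (has k)).inv fun t => haa (y t)).neg
    refine hn.mul ?_
    fin_cases i <;> simp only [cross_apply] <;>
      exact ((has _).mul (hys _)).sub ((has _).mul (hys _))
  · intro t t' h
    simp only [h, hc.deriv_eq h]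
  · intro t
    rw [crossMatrix_mulVec]
    show a (y t) ⨯₃ (-(a (y t) ⬝ᵥ a (y t))⁻¹ • (a (y t) ⨯₃ (deriv y t).ofLp)) = _
    rw [map_smul]
    have h0 := haa (y t)
    have h1 := hay t
    have h2 : a (y t) ⨯₃ (a (y t) ⨯₃ (deriv y t).ofLp) =
        (a (y t) ⬝ᵥ (deriv y t).ofLp) • a (y t) - (a (y t) ⬝ᵥ a (y t)) • (deriv y t).ofLp := by
      generalize a (y t) = a
      generalize (deriv y t).ofLp = u
      simp only [cross_apply, dotProduct, Fin.sum_univ_three]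
      ext i
      fin_cases i <;> simp <;> ring
    rw [h2, h1, zero_smul, zero_sub, smul_neg, neg_smul, neg_neg, smul_smul, inv_mul_cancel₀ h0,
      one_smul]

theorem mainTheorem3 (n : ℕ) (U : Set (EuclideanSpace ℝ (Fin n)))
    (hU : IsOpen U) (hUc : ContractibleSpace U)
    (f : EuclideanSpace ℝ (Fin n) → EuclideanSpace ℝ (Fin n)) (hf : ContDiffOn ℝ ∞ f U)
    (y : ℝ → EuclideanSpace ℝ (Fin n)) (hy : IsSolutionIn U f y)
    (T : ℝ) (hT : 0 < T) (hper : Function.Periodic y T)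
    (hunknotted : IsUnknotted (Set.range y)) :
    ∃ (H : EuclideanSpace ℝ (Fin n) → ℝ)
      (B : EuclideanSpace ℝ (Fin n) → Matrix (Fin n) (Fin n) ℝ),
      ContDiffOn ℝ ∞ H U ∧
      IsPoissonMatrixOn U B ∧
      (∀ x ∈ U, (B x).rank = 2) ∧
      IsSolutionIn U (poissonField B H) y := by
  have hn := hunknotted.two_le
  have hc := hy.isPeriodicOrbit hU hf hT hper hunknotted.not_subsingleton
  -- The secant count behind the projection needs dimension four, so two and three are separate; in
  -- the plane the standard bivector already spans every velocity.
  rcases lt_or_ge n 4 with h4 | h4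
  · obtain rfl | rfl : n = 2 ∨ n = 3 := by omega
    · refine hc.exists_poisson_of_wedge hy (v := EuclideanSpace.single 0 1)
        (Y := fun _ => EuclideanSpace.single 1 1) (by simp) contDiff_const (fun _ => by simp)
        (fun _ => by simp [EuclideanSpace.inner_single_left]) (fun _ _ => rfl)
        fun t => ⟨deriv y t 0, deriv y t 1, ?_⟩
      ext i
      fin_cases i <;> simp
    · exact hc.exists_poisson_of_three hy
  · obtain ⟨v, Y, hv, hY, hY0, hvY, hinv, htan⟩ := hc.exists_transverse_field (by simpa using h4)
    exact hc.exists_poisson_of_wedge hy (norm_ne_zero_iff.1 (by simp [hv])) hY hY0 hvY hinv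
      fun t => ⟨⟪v, deriv y t⟫, 1, by rw [one_smul]; exact htan t⟩
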